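/- Let $G$ be a totally disconnected, metrizable, locally compact group with identity $e$, let $\operatorname{Aut}(G)$ be the group of topological automorphisms of $G$ (group automorphisms that are homeomorphisms), and let $\Gamma$ be a subgroup of $\operatorname{Aut}(G)$ that contains a polycyclic subgroup of finite index. Then the following conditions are equivalent: (i) $\Gamma$ is distal, that is, for every $x\in G$ with $x\neq e$, the identity $e$ is not in the closure of the orbit $\{\gamma(x) : \gamma\in\Gamma\}$; (ii) every $\gamma\in\Gamma$ is distal, that is, for every $\gamma\in\Gamma$ the cyclic subgroup $\langle\gamma\rangle$ of $\operatorname{Aut}(G)$ generated by $\gamma$ is distal in the sense of (i); (iii) $\Gamma$ is equicontinuous, that is, the neighbourhoods $V$ of $e$ with $\gamma(V)=V$ for all $\gamma\in\Gamma$ form a neighbourhood base at $e$. Here a group $P$ is polycyclic if it has a finite series $\{1\}=H_0\le H_1\le\dots\le H_n=P$ of subgroups such that, for each $i<n$, $H_i$ is normal in $H_{i+1}$ and $H_{i+1}/H_i$ is cyclic. -/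

import Mathlib

open Topology

/-- A group is polycyclic if it has a finite subnormal series
`1 = H 0 ⊴ H 1 ⊴ ⋯ ⊴ H n = P` all of whose factors `H (i + 1) / H i` are cyclic. -/
def IsPolycyclic (P : Type*) [Group P] : Prop :=
  ∃ (n : ℕ) (H : ℕ → Subgroup P), H 0 = ⊥ ∧ H n = ⊤ ∧
    ∀ i < n, H i ≤ H (i + 1) ∧
      ∃ _ : ((H i).subgroupOf (H (i + 1))).Normal,
        IsCyclic (H (i + 1) ⧸ (H i).subgroupOf (H (i + 1)))

section TopologicalAutomorphisms

variable {G : Type*} [Group G] [TopologicalSpace G]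

/-- The group of topological automorphisms of `G`, under composition. -/
instance ContinuousMulEquiv.instGroupAut : Group (G ≃ₜ* G) where
  mul γ δ := δ.trans γ
  one := ContinuousMulEquiv.refl G
  inv γ := γ.symm
  mul_assoc _ _ _ := rfl
  one_mul _ := rfl
  mul_one _ := rfl
  inv_mul_cancel γ := ContinuousMulEquiv.ext fun x => γ.symm_apply_apply x

theorem ContinuousMulEquiv.aut_mul_apply (γ δ : G ≃ₜ* G) (x : G) : (γ * δ) x = γ (δ x) := rfl

theorem ContinuousMulEquiv.aut_one_apply (x : G) : (1 : G ≃ₜ* G) x = x := rfl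

theorem ContinuousMulEquiv.aut_inv_apply (γ : G ≃ₜ* G) (x : G) : γ⁻¹ x = γ.symm x := rfl

/-- A group `Γ` of topological automorphisms of `G` is distal if, for every `x ≠ 1`,
the identity is not in the closure of the orbit of `x` under `Γ`. -/
def IsDistalGroup (Γ : Subgroup (G ≃ₜ* G)) : Prop :=
  ∀ x : G, x ≠ 1 → (1 : G) ∉ closure {y : G | ∃ γ ∈ Γ, γ x = y}

/-- A topological automorphism is distal if the subgroup it generates is distal. -/
def IsDistalAut (γ : G ≃ₜ* G) : Prop :=
  IsDistalGroup (Subgroup.zpowers γ)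

/-- A group `Γ` of topological automorphisms of `G` is equicontinuous (at the identity) if
the `Γ`-invariant neighbourhoods of the identity form a neighbourhood base there. -/
def IsEquicontinuousGroup (Γ : Subgroup (G ≃ₜ* G)) : Prop :=
  (𝓝 (1 : G)).HasBasis (fun V : Set G => V ∈ 𝓝 (1 : G) ∧ ∀ γ ∈ Γ, γ '' V = V) id

end TopologicalAutomorphisms

attribute [local instance] Ultrafilter.add Ultrafilter.addSemigroup

/-! The substance is that distality of single elements gives equicontinuity. For distal `α` and
compact open `U`, a point whose forward orbit stays in `U` is recurrent, so its backward orbit stays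
in `U` too. By compactness finitely many iterates already decide this, so the largest `α`-invariant
subset of `U` is open (`IsDistalAut.isOpen_setOf_zpow_apply_mem`). Invariant compact open sets then
climb the polycyclic series, one cyclic factor at a time, and pass to the finite-index overgroup by
a finite intersection. -/

theorem exists_idempotent_ultrafilter_pnat : ∃ p : Ultrafilter ℕ+, p + p = p :=
  exists_idempotent_of_compact_t2_of_continuous_add_left Ultrafilter.continuous_add_left

section InvariantNeighbourhoods

variable {G : Type*} [Group G] [TopologicalSpace G]

/-- The compact open neighbourhoods of the identity that are mapped into themselves by all
members of `S` form a neighbourhood base at the identity. -/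
def HasInvariantCompactOpenBasis (S : Set (G ≃ₜ* G)) : Prop :=
  ∀ U ∈ 𝓝 (1 : G), ∃ V ⊆ U, IsCompact V ∧ IsOpen V ∧ (1 : G) ∈ V ∧ ∀ γ ∈ S, ∀ x ∈ V, γ x ∈ V

theorem IsDistalGroup.mono {Γ Δ : Subgroup (G ≃ₜ* G)} (h : IsDistalGroup Γ) (hle : Δ ≤ Γ) :
    IsDistalGroup Δ := fun x hx hc =>
  h x hx (closure_mono (by rintro _ ⟨γ, hγ, rfl⟩; exact ⟨γ, hle hγ, rfl⟩) hc)

theorem IsDistalAut.inv {α : G ≃ₜ* G} (h : IsDistalAut α) : IsDistalAut α⁻¹ := by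
  unfold IsDistalAut
  rwa [Subgroup.zpowers_inv]

/-- A distal automorphism is recurrent at every point whose forward orbit is relatively compact. -/
theorem IsDistalAut.exists_pow_mem_of_forward_orbit [IsTopologicalGroup G] [T2Space G]
    {α : G ≃ₜ* G} (hα : IsDistalAut α) {K : Set G} (hK : IsCompact K) {x : G}
    (hx : ∀ n : ℕ, (α ^ n) x ∈ K) {O : Set G} (hO : O ∈ 𝓝 x) :
    ∃ n : ℕ, (α ^ (n + 1)) x ∈ O := by
  obtain ⟨p, hp⟩ := exists_idempotent_ultrafilter_pnat
  let f : G → ℕ+ → G := fun z n => (α ^ (n : ℕ)) z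
  obtain ⟨y, -, hy⟩ := hK.ultrafilter_le_nhds (p.map (f x))
    (Filter.tendsto_principal.2 (Filter.Eventually.of_forall fun n : ℕ+ => hx n))
  have hxy : Filter.Tendsto (f x) p (𝓝 y) := hy
  -- Idempotence splits the limit of `α ^ n x` along `p` into an iterated one, so `y` returns to
  -- itself along `p`.
  have hyy : Filter.Tendsto (f y) p (𝓝 y) := by
    refine (closed_nhds_basis y).tendsto_right_iff.2 fun C ⟨hC, hCc⟩ => ?_
    have h1 : ∀ᶠ n in (p + p : Ultrafilter ℕ+), f x n ∈ C := by
      rw [hp]; exact hxy hC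
    rw [Ultrafilter.eventually_add] at h1
    filter_upwards [h1] with m hm
    have h2 : Filter.Tendsto (fun n => (α ^ (m : ℕ)) (f x n)) p (𝓝 (f y m)) :=
      ((α ^ (m : ℕ)).continuous.tendsto y).comp hxy
    refine hCc.mem_of_tendsto h2 ?_
    filter_upwards [hm] with n hn
    simpa [f, pow_add, ContinuousMulEquiv.aut_mul_apply] using hn
  -- Along `p` both `x` and `y` tend to `y`, so the orbit of `x⁻¹ * y` accumulates at `1`; distality
  -- forces `y = x`.
  have hlim : Filter.Tendsto (f (x⁻¹ * y)) p (𝓝 1) := by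
    have := hxy.inv.mul hyy
    simpa [f, map_mul, map_inv] using this
  have hxeq : y = x := by
    by_contra hne
    refine hα (x⁻¹ * y) (fun h => hne (inv_mul_eq_one.1 h).symm) ?_
    exact mem_closure_of_tendsto hlim (Filter.Eventually.of_forall fun n =>
      ⟨α ^ (n : ℕ), Subgroup.npow_mem_zpowers α n, rfl⟩)
  subst hxeq
  obtain ⟨n, hn : (α ^ (n : ℕ)) y ∈ O⟩ := (hxy.eventually hO).exists
  obtain ⟨k, hk⟩ := Nat.exists_eq_succ_of_ne_zero n.ne_zero
  exact ⟨k, by rwa [hk] at hn⟩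

/-- Recurrence gives this for infinite forward orbits; the compact sets `V m` decrease to that case,
so some finite `m` suffices. -/
theorem IsDistalAut.exists_forall_inv_apply_mem [IsTopologicalGroup G] [T2Space G]
    {α : G ≃ₜ* G} (hα : IsDistalAut α) {U : Set G} (hU : IsCompact U) (hUo : IsOpen U) :
    ∃ m : ℕ, ∀ x, (∀ n ≤ m, (α ^ n) x ∈ U) → α⁻¹ x ∈ U := by
  let V : ℕ → Set G := fun m => ⋂ n ≤ m, ⇑(α ^ n) ⁻¹' U
  have hclosed : ∀ m, IsClosed (V m) := fun m =>
    isClosed_biInter fun n _ => hU.isClosed.preimage (α ^ n).continuous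
  have hcompact : ∀ m, IsCompact (V m) := fun m =>
    hU.of_isClosed_subset (hclosed m) fun x hx => by
      simpa [ContinuousMulEquiv.aut_one_apply] using Set.mem_iInter₂.1 hx 0 (Nat.zero_le m)
  have hanti : Antitone V := fun m k hmk =>
    Set.biInter_subset_biInter_left fun n (hn : n ≤ m) => hn.trans hmk
  obtain ⟨m, hm⟩ := exists_subset_nhds_of_isCompact' hanti.directed_ge hcompact hclosed
    (U := ⇑(α⁻¹) ⁻¹' U) fun x hx => by
      refine (hUo.preimage (α⁻¹).continuous).mem_nhds ?_
      have hx' : ∀ n : ℕ, (α ^ n) x ∈ U := fun n =>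
        Set.mem_iInter₂.1 (Set.mem_iInter.1 hx n) n le_rfl
      by_contra hxU
      obtain ⟨n, hn⟩ := hα.exists_pow_mem_of_forward_orbit hU hx'
        ((hU.isClosed.preimage (α⁻¹).continuous).isOpen_compl.mem_nhds hxU)
      refine hn ?_
      change α⁻¹ ((α ^ (n + 1)) x) ∈ U
      rw [← ContinuousMulEquiv.aut_mul_apply, pow_succ', inv_mul_cancel_left]
      exact hx' n
  exact ⟨m, fun x hx => hm (Set.mem_iInter₂.2 hx)⟩

theorem IsDistalAut.exists_forall_inv_pow_apply_mem [IsTopologicalGroup G] [T2Space G]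
    {α : G ≃ₜ* G} (hα : IsDistalAut α) {U : Set G} (hU : IsCompact U) (hUo : IsOpen U) :
    ∃ m : ℕ, ∀ x, (∀ n ≤ m, (α ^ n) x ∈ U) → ∀ k : ℕ, (α⁻¹ ^ k) x ∈ U := by
  obtain ⟨m, hm⟩ := hα.exists_forall_inv_apply_mem hU hUo
  refine ⟨m, fun x hx k => ?_⟩
  -- The whole window of `m + 1` iterates slides back one step at a time.
  suffices h : ∀ n ≤ m, (α ^ n) ((α⁻¹ ^ k) x) ∈ U by simpa [ContinuousMulEquiv.aut_one_apply] using h 0 (Nat.zero_le m)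
  induction k with
  | zero => simpa [ContinuousMulEquiv.aut_one_apply] using hx
  | succ k ih =>
    intro n hn
    rw [pow_succ', ContinuousMulEquiv.aut_mul_apply]
    cases n with
    | zero => exact hm _ ih
    | succ n =>
      rw [← ContinuousMulEquiv.aut_mul_apply, pow_succ, mul_inv_cancel_right]
      exact ih n (by omega)

/-- For a distal automorphism, the points of a compact open set whose whole orbit stays in this set
form an open set. -/
theorem IsDistalAut.isOpen_setOf_zpow_apply_mem [IsTopologicalGroup G] [T2Space G]
    {α : G ≃ₜ* G} (hα : IsDistalAut α) {U : Set G} (hU : IsCompact U) (hUo : IsOpen U) :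
    IsOpen {x | ∀ k : ℤ, (α ^ k) x ∈ U} := by
  obtain ⟨m, hm⟩ := hα.exists_forall_inv_pow_apply_mem hU hUo
  obtain ⟨l, hl⟩ := hα.inv.exists_forall_inv_pow_apply_mem hU hUo
  have heq : {x | ∀ k : ℤ, (α ^ k) x ∈ U} =
      (⋂ n ∈ Set.Iic m, ⇑(α ^ n) ⁻¹' U) ∩ ⋂ n ∈ Set.Iic l, ⇑(α⁻¹ ^ n) ⁻¹' U := by
    ext x
    simp only [Set.mem_ofPred_eq, Set.mem_inter_iff, Set.mem_iInter₂, Set.mem_preimage, Set.mem_Iic]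
    refine ⟨fun h => ⟨fun n _ => by simpa using h n, fun n _ => by simpa using h (-n)⟩, ?_⟩
    rintro ⟨h1, h2⟩ k
    obtain ⟨n, rfl | rfl⟩ := k.eq_nat_or_neg
    · simpa using hl x h2 n
    · simpa using hm x h1 n
  rw [heq]
  exact ((Set.finite_Iic m).isOpen_biInter fun n _ => hUo.preimage (α ^ n).continuous).inter
    ((Set.finite_Iic l).isOpen_biInter fun n _ => hUo.preimage (α⁻¹ ^ n).continuous)

theorem hasInvariantCompactOpenBasis_singleton_one [IsTopologicalGroup G]
    [TotallyDisconnectedSpace G] [T2Space G] [LocallyCompactSpace G] :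
    HasInvariantCompactOpenBasis ({1} : Set (G ≃ₜ* G)) := by
  intro U hU
  obtain ⟨K, hK, hKU, hKc⟩ := local_compact_nhds hU
  obtain ⟨V, hV, h1, hVK⟩ := loc_compact_Haus_tot_disc_of_zero_dim.mem_nhds_iff.1 hK
  exact ⟨V, hVK.trans hKU, hKc.of_isClosed_subset hV.isClosed hVK, hV.isOpen, h1,
    fun γ hγ x hx => by rw [Set.mem_singleton_iff.1 hγ]; exact hx⟩

theorem IsPolycyclic.hasInvariantCompactOpenBasis [IsTopologicalGroup G]
    [TotallyDisconnectedSpace G] [T2Space G] [LocallyCompactSpace G]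
    {P : Type*} [Group P] (hP : IsPolycyclic P) (f : P →* (G ≃ₜ* G))
    (hf : ∀ p, IsDistalAut (f p)) : HasInvariantCompactOpenBasis (Set.range f) := by
  obtain ⟨n, H, h0, hn, hH⟩ := hP
  suffices h : ∀ i ≤ n, HasInvariantCompactOpenBasis (f '' (H i : Set P)) by
    simpa [hn] using h n le_rfl
  intro i
  induction i with
  | zero => simpa [h0] using hasInvariantCompactOpenBasis_singleton_one
  | succ i ih =>
    intro hi U hU
    obtain ⟨V, hVU, hVc, hVo, hV1, hV⟩ := ih (by omega) U hU
    obtain ⟨-, hnormal, hcyclic⟩ := hH i hi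
    obtain ⟨q, hq⟩ := hcyclic.exists_generator
    obtain ⟨g, rfl⟩ := QuotientGroup.mk_surjective q
    have hdecomp : ∀ h ∈ H (i + 1), ∃ a ∈ H i, ∃ j : ℤ, h = a * (g : P) ^ j := by
      intro h hh
      obtain ⟨j, hj⟩ := hq (QuotientGroup.mk ⟨h, hh⟩)
      have hmem := hnormal.mem_comm
        (QuotientGroup.eq.1 ((QuotientGroup.mk_zpow _ g j).trans hj))
      exact ⟨h * ((g : P) ^ j)⁻¹, by simpa [Subgroup.mem_subgroupOf] using hmem, j, by simp⟩
    have hsub : {x | ∀ k : ℤ, (f g ^ k) x ∈ V} ⊆ V := fun x hx => by simpa [ContinuousMulEquiv.aut_one_apply] using hx 0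
    refine ⟨{x | ∀ k : ℤ, (f g ^ k) x ∈ V}, hsub.trans hVU, ?_,
      (hf g).isOpen_setOf_zpow_apply_mem hVc hVo, by simpa using hV1, ?_⟩
    · refine hVc.of_isClosed_subset ?_ hsub
      rw [Set.ofPred_forall]
      exact isClosed_iInter fun k => hVc.isClosed.preimage (f g ^ k).continuous
    · rintro _ ⟨h, hh, rfl⟩ x hx k
      -- Write `g ^ k * h = a * g ^ j` with `a ∈ H i`: `g ^ j` keeps `x` in `V` by choice of `x`,
      -- and `a` preserves `V`.
      obtain ⟨a, ha, j, hj⟩ :=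
        hdecomp ((g : P) ^ k * h) (mul_mem (zpow_mem g.2 k) hh)
      rw [← map_zpow, ← ContinuousMulEquiv.aut_mul_apply, ← map_mul, hj, map_mul, map_zpow,
        ContinuousMulEquiv.aut_mul_apply]
      exact hV _ ⟨a, ha, rfl⟩ _ (hx j)

theorem HasInvariantCompactOpenBasis.of_finiteIndex [T2Space G]
    {L : Type*} [Group L] (f : L →* (G ≃ₜ* G)) (P : Subgroup L) [P.FiniteIndex]
    (h : HasInvariantCompactOpenBasis (f '' (P : Set L))) :
    HasInvariantCompactOpenBasis (Set.range f) := by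
  intro U hU
  obtain ⟨V, hVU, hVc, hVo, hV1, hV⟩ := h U hU
  -- Since `V` is `P`-invariant, one representative per coset suffices. The quotient is by left
  -- cosets, hence the inverses.
  have heq : {x | ∀ g, f g x ∈ V} = ⋂ q : L ⧸ P, ⇑(f q.out⁻¹) ⁻¹' V := by
    ext x
    simp only [Set.mem_ofPred_eq, Set.mem_iInter, Set.mem_preimage]
    refine ⟨fun hx q => hx _, fun hx g => ?_⟩
    obtain ⟨p, hp⟩ := QuotientGroup.mk_out_eq_mul P g⁻¹
    have hg : g = p * (QuotientGroup.mk (s := P) g⁻¹).out⁻¹ := by simp [hp]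
    rw [hg, map_mul, ContinuousMulEquiv.aut_mul_apply]
    exact hV _ ⟨p, p.2, rfl⟩ _ (hx _)
  have hsub : {x | ∀ g, f g x ∈ V} ⊆ V := fun x hx => by simpa [ContinuousMulEquiv.aut_one_apply] using hx 1
  refine ⟨{x | ∀ g, f g x ∈ V}, hsub.trans hVU, hVc.of_isClosed_subset ?_ hsub, ?_,
    by simpa using hV1, ?_⟩
  · rw [heq]
    exact isClosed_iInter fun q => hVc.isClosed.preimage (f _).continuous
  · rw [heq]
    exact isOpen_iInter_of_finite fun q => hVo.preimage (f _).continuous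
  · rintro _ ⟨g, rfl⟩ x hx k
    rw [← ContinuousMulEquiv.aut_mul_apply, ← map_mul]
    exact hx _

theorem HasInvariantCompactOpenBasis.isEquicontinuousGroup {Γ : Subgroup (G ≃ₜ* G)}
    (h : HasInvariantCompactOpenBasis (Γ : Set (G ≃ₜ* G))) : IsEquicontinuousGroup Γ := by
  refine ⟨fun U => ⟨fun hU => ?_, fun ⟨V, hV, hVU⟩ => Filter.mem_of_superset hV.1 hVU⟩⟩
  obtain ⟨V, hVU, -, hVo, hV1, hV⟩ := h U hU
  refine ⟨V, ⟨hVo.mem_nhds hV1, fun γ hγ => ?_⟩, hVU⟩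
  refine Set.Subset.antisymm (Set.image_subset_iff.2 (hV γ hγ)) fun x hx => ?_
  exact ⟨γ⁻¹ x, hV _ (inv_mem hγ) x hx, γ.apply_symm_apply x⟩

theorem IsEquicontinuousGroup.isDistalGroup [T1Space G] {Γ : Subgroup (G ≃ₜ* G)}
    (h : IsEquicontinuousGroup Γ) : IsDistalGroup Γ := by
  intro x hx hcl
  obtain ⟨V, ⟨hV, hinv⟩, hVx⟩ := h.mem_iff.1 (isOpen_compl_singleton.mem_nhds hx.symm)
  obtain ⟨_, hyV, γ, hγ, rfl⟩ := mem_closure_iff_nhds.1 hcl V hV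
  rw [← hinv γ hγ] at hyV
  obtain ⟨z, hz, hzx⟩ := hyV
  exact hVx hz (γ.injective hzx)

end InvariantNeighbourhoods

theorem corollary2p4 {G : Type*} [Group G] [TopologicalSpace G] [IsTopologicalGroup G]
    [TotallyDisconnectedSpace G] [TopologicalSpace.MetrizableSpace G] [LocallyCompactSpace G]
    (Γ : Subgroup (G ≃ₜ* G))
    (hΓ : ∃ P : Subgroup Γ, IsPolycyclic P ∧ P.FiniteIndex) :
    List.TFAE [
      IsDistalGroup Γ,
      ∀ γ ∈ Γ, IsDistalAut γ,
      IsEquicontinuousGroup Γ] := by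

  tfae_have 1 → 2 := fun h γ hγ => h.mono ((Subgroup.zpowers_le).2 hγ)
  tfae_have 2 → 3 := by
    intro h
    obtain ⟨P, hP, hfin⟩ := hΓ
    have hb := hP.hasInvariantCompactOpenBasis (Γ.subtype.comp P.subtype) fun p => h _ p.1.2
    have := HasInvariantCompactOpenBasis.of_finiteIndex Γ.subtype P
      (by simpa [Set.range_comp] using hb)
    exact HasInvariantCompactOpenBasis.isEquicontinuousGroup (by simpa using this)
  tfae_have 3 → 1 := fun h => h.isDistalGroup
  tfae_finish
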